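/- Let $V$ be a finite set of spins, each with local Hilbert space $\mathbb{C}^d$, and let $S$ be a set of subsystems (subsets of $V$). Let $H=H(\lambda)=\sum_{X\in S}\lambda_X h_X$, where each $h_X$ is a Hermitian operator on $(\mathbb{C}^d)^{\otimes V}$ with support exactly $X$ and operator norm $\|h_X\|=1$, and the coefficients $\lambda_X$ are real with $|\lambda_X|\le 1$. Let $\mathfrak d$ be the maximum degree of the interaction graph, which has vertex set $S$ and an edge between any two distinct subsystems that overlap; assume $\mathfrak d\ge 1$. Let $\rho=\bigotimes_{v\in V}\rho_v$ be a (possibly mixed) product state, let $L(t)=\operatorname{tr}(e^{-iHt}\rho)$ for $t\in\mathbb{C}$, and let $t_L^*=1/[2e^2\mathfrak d(\mathfrak d+1)]$. A cluster $\mathbf W$ of size $m\geq 1$ is a multiset of $m$ elements of $S$, with multiplicities $\mu_{\mathbf W}(X)$. It is connected if the graph whose vertices are its elements (repeated according to multiplicity), with edges between distinct vertices whose subsystems overlap, is connected; $\mathcal G_m$ is the set of connected clusters of size $m$. Write $\lambda^{\mathbf W}=\prod_X\lambda_X^{\mu_{\mathbf W}(X)}$, $\mathbf W!=\prod_X\mu_{\mathbf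 W}(X)!$, and $\mathcal D_{\mathbf W}f=\big[\prod_X(\partial/\partial\lambda_X)^{\mu_{\mathbf W}(X)}\big]f(\lambda)\big|_{\lambda=0}$. In $\mathcal D_{\mathbf W}\log L(t)$, $L(t)$ is regarded as a function of $\lambda$ at fixed $t$, and $\log$ is the principal logarithm, which is smooth there because $L(t)=1$ at $\lambda=0$. Then $L(t)\neq 0$ for all complex $t$ with $|t|<t_L^*$, and $\log L(t)$, meaning the branch on this disc with $\log L(0)=0$, is analytic there. Moreover, for every integer $M\ge 0$ and every complex $t$ with $|t|<t_L^*$, $$\left|\log L(t)-\sum_{m=1}^{M}\ \sum_{\mathbf W\in\mathcal G_m}\frac{\lambda^{\mathbf W}}{\mathbf W!}\,\mathcal D_{\mathbf W}\log L(t)\right|\ \le\ |S|\,\frac{(|t|/t_L^*)^{M+1}}{1-|t|/t_L^*}.$$ -/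

import Mathlib

open scoped ComplexOrder

noncomputable section

namespace QSpin

variable {V : Type*} [Fintype V] [DecidableEq V] {d : ℕ}

/-- Operators on `⨂_{v ∈ V} ℂ^d`, as matrices in the product basis, whose vectors are labelled by
the configurations `V → Fin d`. -/
abbrev Op (V : Type*) (d : ℕ) : Type _ := Matrix (V → Fin d) (V → Fin d) ℂ

/-- `A` acts trivially outside `X`: `A = B ⊗ 1` with `B` an operator on the spins in `X`. -/
def ActsOn (A : Op V d) (X : Finset V) : Prop :=
  ∃ B : Matrix (X → Fin d) (X → Fin d) ℂ, ∀ σ τ : V → Fin d,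
    A σ τ = if ∀ v, v ∉ X → σ v = τ v then B (fun v => σ v) (fun v => τ v) else 0

/-- `X = supp A`: the smallest subsystem on which `A` acts nontrivially. -/
def HasSupport (A : Op V d) (X : Finset V) : Prop :=
  IsLeast {Y : Finset V | ActsOn A Y} X

/-- The operator norm for the Euclidean (Hilbert space) norm. -/
def opNorm (A : Op V d) : ℝ := ‖Matrix.toEuclideanCLM (𝕜 := ℂ) A‖

/-- `ρ = ⨂_v r_v` with a (possibly mixed) one-spin state `r_v` at each spin. -/
def IsProductState (ρ : Op V d) : Prop :=
  ∃ r : V → Matrix (Fin d) (Fin d) ℂ,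
    (∀ v, (r v).PosSemidef ∧ (r v).trace = 1) ∧
    ∀ σ τ : V → Fin d, ρ σ τ = ∏ v, r v (σ v) (τ v)

/-- `H = ∑_{X ∈ S} l_X h_X`. -/
def hamiltonian {S : Finset (Finset V)} (h : S → Op V d) (l : S → ℝ) : Op V d :=
  ∑ X : S, (l X : ℂ) • h X

/-- `L(t) = tr (e^{-iHt} ρ)`, as a function of the coefficients `l` and of the time `t`. -/
def loschmidt {S : Finset (Finset V)} (h : S → Op V d) (ρ : Op V d) (l : S → ℝ) (t : ℂ) : ℂ :=
  (NormedSpace.exp ((-Complex.I * t) • hamiltonian h l) * ρ).trace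

/-- Vertices are the subsystems in `S`; distinct overlapping subsystems are adjacent. -/
def interactionGraph (S : Finset (Finset V)) : SimpleGraph S where
  Adj X Y := X ≠ Y ∧ (X.1 ∩ Y.1).Nonempty
  symm := ⟨fun _ _ hXY => ⟨hXY.1.symm, by rw [Finset.inter_comm]; exact hXY.2⟩⟩
  loopless := ⟨fun _ hX => hX.1 rfl⟩

open Classical in
/-- The maximum degree of the interaction graph. -/
def maxDeg (S : Finset (Finset V)) : ℕ := (interactionGraph S).maxDegree

/-- The cluster graph of a multiset of subsystems: a vertex for each element, counted with
multiplicity, and an edge between distinct vertices whose subsystems overlap. -/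
def clusterGraph {S : Finset (Finset V)} (W : Multiset S) : SimpleGraph W.ToType where
  Adj p q := p ≠ q ∧ (p.1.1 ∩ q.1.1).Nonempty
  symm := ⟨fun _ _ hpq => ⟨hpq.1.symm, by rw [Finset.inter_comm]; exact hpq.2⟩⟩
  loopless := ⟨fun _ hp => hp.1 rfl⟩

open Classical in
/-- The connected clusters of size `m`. -/
def connectedClusters (S : Finset (Finset V)) (m : ℕ) : Finset (Sym S m) :=
  Finset.univ.filter fun W => (clusterGraph (W : Multiset S)).Connected

/-- `l^W = ∏_X l_X ^ μ_W(X)`. -/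
def clusterMonomial {S : Finset (Finset V)} (l : S → ℝ) (W : Multiset S) : ℝ :=
  ∏ X : S, l X ^ W.count X

/-- `W! = ∏_X μ_W(X)!`. -/
def clusterFactorial {S : Finset (Finset V)} (W : Multiset S) : ℕ :=
  ∏ X : S, (W.count X).factorial

/-- The partial derivative `∂f/∂l_X`. -/
def partialDeriv {S : Finset (Finset V)} (X : S) (f : (S → ℝ) → ℂ) : (S → ℝ) → ℂ :=
  fun l => lineDeriv ℝ f l (Pi.single X 1)

/-- The cluster derivative at `l = 0`: one partial derivative for each element of `W`, counted with
multiplicity. The order is immaterial for functions that are smooth near `0`. -/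
def clusterDeriv {S : Finset (Finset V)} (W : Multiset S) (f : (S → ℝ) → ℂ) : ℂ :=
  W.toList.foldr partialDeriv f 0

/-- The cluster expansion of `log L(t)`, restricted to connected clusters of size at most `M`.
Near `l = 0` the value `L(t)` is close to `1`, so the principal logarithm is the branch of
`log L(t)` that vanishes at `l = 0`. -/
def truncatedExpansion {S : Finset (Finset V)} (h : S → Op V d) (ρ : Op V d) (l : S → ℝ)
    (M : ℕ) (t : ℂ) : ℂ :=
  ∑ m ∈ Finset.Icc 1 M, ∑ W ∈ connectedClusters S m,
    ((clusterMonomial l W : ℝ) : ℂ) / (clusterFactorial (W : Multiset S) : ℂ) *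
      clusterDeriv (W : Multiset S) (fun l' => Complex.log (loschmidt h ρ l' t))

/-- `t_L^* = 1 / [2 e² D (D + 1)]`. -/
def loschmidtTime (D : ℕ) : ℝ := 1 / (2 * Real.exp 1 ^ 2 * D * (D + 1))

end QSpin

end

/-!
Absorb `-it` into the coefficients and write `Z A = tr (exp (∑_{X ∈ A} z_X h_X) ρ)` for a family
`A` of subsystems, so that `L(t) = Z S` with `|z_X| ≤ |t|`. The expansion of `log L` is controlled
without counting clusters, by a bound on `log Z S` on the whole disc followed by Cauchy's estimates.

*Bound on the logarithm.* Expanding the exponential into words in the letters `z_X h_X`, the words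
in which all letters of `B` occur and no others sum up to at most `(e^|t| - 1)^|B|`
(`norm_alternatingSum_exp_le`), because the expectation of an operator is at most its norm. In a
product state `Z (A ∪ B) = Z A * Z B` when no subsystem of `A` overlaps one of `B`
(`IsProductState.trace_exp_add_mul`). Let `Z (B | A)` collect the words in `A ∪ B` that use all of
`B`. If `Y ∈ A` overlaps an element of `B`, either `Y` is unused or it is used, so
`Z (B | A) = Z (B | A \ Y) + Z (B ∪ Y | A \ Y)`; once no element of `A` overlaps `B`, the words
factorize. Induction on `|A|` gives `|Z (B | A)| ≤ x^|B| β^n |Z A|`, where `n` is the number of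
elements of `A` that overlap `B` (`exploration_bound`). The case of a single element `B = {Y}`
shows that `Z (A ∪ Y) / Z A` lies within `1/4` of `1`. Hence `Z S ≠ 0`, and the sum of the
principal logarithms of these ratios is an analytic branch of `log L` of modulus at most `|S|`
(`exists_log_partialPartition`). Cauchy's estimates then bound the tail of its Taylor series at
`t = 0` (`norm_sub_taylor_le`).

*Taylor polynomials are cluster sums.* Since `L` depends on `t` and the coefficients only through
their products, the term of order `m` of the Taylor series of `log L` in `t` is the sum over all
clusters of size `m` (`sum_clusterDeriv`). A disconnected cluster contributes nothing: along its
directions `log L` is a sum of a function of the first group of coefficients and a function of the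
second (`clusterDeriv_eq_zero_of_not_connected`).
-/

namespace QSpin

/-! ### The exploration estimate -/

section Exploration

variable {ι E : Type*} [DecidableEq ι] [AddCommGroup E]

/-- The alternating sum `∑_{B' ⊆ B} (-1)^{|B \ B'|} Z (A ∪ B')`. When `Z A` is a sum over words with
letters in `A`, this is the part of `Z (A ∪ B)` coming from the words in which every letter of `B`
occurs. -/
def alternatingSum (Z : Finset ι → E) (B A : Finset ι) : E :=
  ∑ C ∈ B.powerset, (-1 : ℤ) ^ (B \ C).card • Z (A ∪ C)

@[simp]
lemma alternatingSum_empty (Z : Finset ι → E) (A : Finset ι) : alternatingSum Z ∅ A = Z A := by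
  simp [alternatingSum]

/-- The words in which `Y` occurs are those in which it may occur, less those in which it does
not. -/
lemma alternatingSum_insert (Z : Finset ι → E) {B : Finset ι} {Y : ι} (hY : Y ∉ B)
    (A : Finset ι) :
    alternatingSum Z (insert Y B) A = alternatingSum Z B (insert Y A) - alternatingSum Z B A := by
  unfold alternatingSum
  rw [Finset.sum_powerset_insert hY, add_comm, sub_eq_add_neg, ← Finset.sum_neg_distrib]
  congr 1
  · refine Finset.sum_congr rfl fun C hC => ?_
    have hC' := Finset.mem_powerset.1 hC
    rw [Finset.insert_sdiff_insert, Finset.sdiff_insert_of_notMem hY]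
    congr 2
    ext; simp
  · refine Finset.sum_congr rfl fun C hC => ?_
    have hC' := Finset.mem_powerset.1 hC
    have h1 : Y ∉ C := fun h => hY (hC' h)
    rw [Finset.insert_sdiff_of_notMem _ h1, Finset.card_insert_of_notMem (by simp [hY]), pow_succ]
    simp

end Exploration

section Exploration

variable {ι : Type*} [DecidableEq ι] {Z : Finset ι → ℂ} {adj : ι → ι → Prop} [DecidableRel adj]
  {x β : ℝ} {D : ℕ}

/-- The elements of `A` adjacent to an element of `B`. -/
def boundary (adj : ι → ι → Prop) [DecidableRel adj] (B A : Finset ι) : Finset ι :=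
  A.filter fun Y => ∃ X ∈ B, adj X Y

/-- Words in the letters of `A` together with `B`, all letters of `B` occurring, carry a weight of
order `x ^ |B|` relative to `Z A`. The proof decides, for one boundary element `Y` after the other,
whether `Y` occurs; an occurring `Y` brings a factor `x` and at most `D` new boundary elements.
Since removing `Y` from `A` changes `Z A` by a factor of at most `1 / (1 - x β ^ D)`, one such
decision costs `(1 + x β ^ D) / (1 - x β ^ D)`, which `hbd` bounds by `β`. -/
theorem exploration_bound (hZ : Z ∅ = 1)
    (hmul : ∀ A B : Finset ι, Disjoint A B → (∀ X ∈ B, ∀ Y ∈ A, ¬ adj X Y) →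
      Z (A ∪ B) = Z A * Z B)
    (hdeg : ∀ (Y : ι) (A : Finset ι), Y ∉ A → (A.filter (adj Y)).card ≤ D)
    (hx : 0 ≤ x) (hβ : 1 ≤ β)
    (hB : ∀ B : Finset ι, ‖alternatingSum Z B ∅‖ ≤ x ^ B.card)
    (hlt : x * β ^ D < 1) (hbd : 1 + x * β ^ D ≤ β * (1 - x * β ^ D)) (A : Finset ι) :
    Z A ≠ 0 ∧ ∀ B : Finset ι, Disjoint A B →
      ‖alternatingSum Z B A‖ ≤ x ^ B.card * β ^ (boundary adj B A).card * ‖Z A‖ := by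
  have hβ0 : 0 ≤ β := zero_le_one.trans hβ
  induction hn : A.card generalizing A with
  | zero =>
    obtain rfl := Finset.card_eq_zero.1 hn
    refine ⟨by simp [hZ], fun B _ => ?_⟩
    simpa [boundary, hZ] using hB B
  | succ n ih =>
    -- Adding one element changes `Z` by a factor in the disc of radius `x * β ^ D` around `1`.
    have key : ∀ Y ∈ A, (1 - x * β ^ D) * ‖Z (A.erase Y)‖ ≤ ‖Z A‖ := by
      intro Y hY
      obtain ⟨h0, h1⟩ := ih (A.erase Y) (by rw [Finset.card_erase_of_mem hY, hn]; rfl)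
      have h2 := h1 {Y} (by simp)
      have h3 := alternatingSum_insert Z (B := ∅) (Y := Y) (by simp) (A.erase Y)
      rw [alternatingSum_empty, alternatingSum_empty, Finset.insert_erase hY,
        Finset.insert_empty] at h3
      have h4 : (boundary adj {Y} (A.erase Y)).card ≤ D := by
        simpa [boundary] using hdeg Y (A.erase Y) (by simp)
      have h5 : ‖alternatingSum Z {Y} (A.erase Y)‖ ≤ x * β ^ D * ‖Z (A.erase Y)‖ := by
        refine h2.trans ?_
        rw [Finset.card_singleton, pow_one]
        gcongr
      have h6 : Z (A.erase Y) = Z A - alternatingSum Z {Y} (A.erase Y) := by rw [h3]; ring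
      have h7 := norm_sub_le (Z A) (alternatingSum Z {Y} (A.erase Y))
      rw [← h6] at h7
      linarith
    have hne : Z A ≠ 0 := by
      obtain ⟨Y, hY⟩ : A.Nonempty := Finset.card_pos.1 (by omega)
      obtain ⟨h0, -⟩ := ih (A.erase Y) (by rw [Finset.card_erase_of_mem hY, hn]; rfl)
      have := key Y hY
      rw [← norm_pos_iff] at h0 ⊢
      exact lt_of_lt_of_le (mul_pos (by linarith) h0) this
    refine ⟨hne, fun B hAB => ?_⟩
    by_cases hb : boundary adj B A = ∅
    -- Without a boundary the words in `B` and in `A` do not interact.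
    · have h1 : alternatingSum Z B A = alternatingSum Z B ∅ * Z A := by
        unfold alternatingSum
        rw [Finset.sum_mul]
        refine Finset.sum_congr rfl fun C hC => ?_
        have hC' := Finset.mem_powerset.1 hC
        rw [hmul A C (hAB.mono_right hC'), Finset.empty_union, smul_mul_assoc, mul_comm (Z A)]
        intro X hX Y hY h
        have : Y ∈ boundary adj B A := Finset.mem_filter.2 ⟨hY, X, hC' hX, h⟩
        simp [hb] at this
      rw [h1, hb, norm_mul]
      simpa using mul_le_mul_of_nonneg_right (hB B) (norm_nonneg (Z A))
    · obtain ⟨Y, hYb⟩ := Finset.nonempty_iff_ne_empty.2 hb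
      obtain ⟨hYA, X, hXB, hXY⟩ := Finset.mem_filter.1 hYb
      have hYB : Y ∉ B := Finset.disjoint_left.1 hAB hYA
      obtain ⟨h0, h1⟩ := ih (A.erase Y) (by rw [Finset.card_erase_of_mem hYA, hn]; rfl)
      have hdis : Disjoint (A.erase Y) B := hAB.mono_left (Finset.erase_subset _ _)
      have hdis' : Disjoint (A.erase Y) (insert Y B) := by
        rw [Finset.disjoint_insert_right]; exact ⟨by simp, hdis⟩
      have hs := alternatingSum_insert Z hYB (A.erase Y)
      rw [Finset.insert_erase hYA] at hs
      obtain ⟨k, hk⟩ : ∃ k, (boundary adj B A).card = k + 1 :=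
        ⟨_, (Nat.succ_pred_eq_of_pos (Finset.card_pos.2 ⟨Y, hYb⟩)).symm⟩
      have hk1 : (boundary adj B (A.erase Y)).card = k := by
        have : boundary adj B (A.erase Y) = (boundary adj B A).erase Y := by
          unfold boundary; rw [Finset.filter_erase]
        rw [this, Finset.card_erase_of_mem hYb, hk]; rfl
      have hk2 : (boundary adj (insert Y B) (A.erase Y)).card ≤ k + D := by
        have : boundary adj (insert Y B) (A.erase Y) ⊆
            boundary adj B (A.erase Y) ∪ (A.erase Y).filter (adj Y) := by
          intro U hU
          simp only [boundary, Finset.mem_filter, Finset.mem_insert, Finset.mem_union] at hU ⊢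
          obtain ⟨hU, T, rfl | hT, hTU⟩ := hU
          · exact Or.inr ⟨hU, hTU⟩
          · exact Or.inl ⟨hU, T, hT, hTU⟩
        refine (Finset.card_le_card this).trans ((Finset.card_union_le _ _).trans ?_)
        rw [hk1]
        exact Nat.add_le_add_left (hdeg Y _ (by simp)) k
      have e1 := h1 B hdis
      have e2 := h1 (insert Y B) hdis'
      rw [hk1] at e1
      have e3 : ‖alternatingSum Z (insert Y B) (A.erase Y)‖ ≤
          x ^ B.card * β ^ k * (x * β ^ D) * ‖Z (A.erase Y)‖ := by
        refine e2.trans ?_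
        rw [Finset.card_insert_of_notMem hYB]
        calc _ ≤ x ^ (B.card + 1) * β ^ (k + D) * ‖Z (A.erase Y)‖ := by gcongr
          _ = _ := by ring
      have e4 : alternatingSum Z B A = alternatingSum Z B (A.erase Y) +
          alternatingSum Z (insert Y B) (A.erase Y) := by rw [hs]; abel
      have hpos : 0 ≤ x ^ B.card * β ^ k := by positivity
      calc ‖alternatingSum Z B A‖
          ≤ x ^ B.card * β ^ k * ‖Z (A.erase Y)‖ +
            x ^ B.card * β ^ k * (x * β ^ D) * ‖Z (A.erase Y)‖ := by
              rw [e4]; exact (norm_add_le _ _).trans (add_le_add e1 e3)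
        _ = x ^ B.card * β ^ k * ((1 + x * β ^ D) * ‖Z (A.erase Y)‖) := by ring
        _ ≤ x ^ B.card * β ^ k * (β * (1 - x * β ^ D) * ‖Z (A.erase Y)‖) := by gcongr
        _ = x ^ B.card * β ^ k * (β * ((1 - x * β ^ D) * ‖Z (A.erase Y)‖)) := by ring
        _ ≤ x ^ B.card * β ^ k * (β * ‖Z A‖) := by gcongr; exact key Y hYA
        _ = _ := by rw [hk]; ring

/-- Adding one element to `A` multiplies `Z A` by a factor close to `1`. -/
theorem norm_insert_div_sub_one_le (hZ : Z ∅ = 1)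
    (hmul : ∀ A B : Finset ι, Disjoint A B → (∀ X ∈ B, ∀ Y ∈ A, ¬ adj X Y) →
      Z (A ∪ B) = Z A * Z B)
    (hdeg : ∀ (Y : ι) (A : Finset ι), Y ∉ A → (A.filter (adj Y)).card ≤ D)
    (hx : 0 ≤ x) (hβ : 1 ≤ β)
    (hB : ∀ B : Finset ι, ‖alternatingSum Z B ∅‖ ≤ x ^ B.card)
    (hlt : x * β ^ D < 1) (hbd : 1 + x * β ^ D ≤ β * (1 - x * β ^ D))
    {A : Finset ι} {Y : ι} (hY : Y ∉ A) :
    ‖Z (insert Y A) / Z A - 1‖ ≤ x * β ^ D := by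
  obtain ⟨h0, h1⟩ := exploration_bound hZ hmul hdeg hx hβ hB hlt hbd A
  have h2 := h1 {Y} (by simpa using hY)
  have h3 := alternatingSum_insert Z (B := ∅) (Y := Y) (by simp) A
  rw [alternatingSum_empty, alternatingSum_empty, Finset.insert_empty] at h3
  have h4 : (boundary adj {Y} A).card ≤ D := by simpa [boundary] using hdeg Y A hY
  rw [div_sub_one h0, norm_div, div_le_iff₀ (norm_pos_iff.2 h0), ← h3]
  refine h2.trans ?_
  rw [Finset.card_singleton, pow_one]
  gcongr

end Exploration

/-! ### Norms of alternating sums of exponentials -/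

section AlternatingExp

variable {ι : Type*} [DecidableEq ι]

lemma alternatingSum_add_erase {E : Type*} [AddCommGroup E] (Z : Finset ι → E) {B : Finset ι}
    {X : ι} (hX : X ∈ B) (A : Finset ι) :
    alternatingSum Z B A + alternatingSum Z (B.erase X) A =
      alternatingSum Z (B.erase X) (insert X A) := by
  have := alternatingSum_insert Z (Finset.notMem_erase X B) A
  rw [Finset.insert_erase hX] at this
  rw [this]; abel

/-- The recursion behind the bound on alternating sums: split off the first factor of the power. -/
lemma alternatingSum_pow_succ {R : Type*} [Ring R] (k : ι → R) (n : ℕ) (B : Finset ι) :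
    alternatingSum (fun A => (∑ X ∈ A, k X) ^ (n + 1)) B ∅ =
      ∑ X ∈ B, k X * (alternatingSum (fun A => (∑ X ∈ A, k X) ^ n) B ∅ +
        alternatingSum (fun A => (∑ X ∈ A, k X) ^ n) (B.erase X) ∅) := by
  have h1 : alternatingSum (fun A => (∑ X ∈ A, k X) ^ (n + 1)) B ∅ =
      ∑ X ∈ B, ∑ C ∈ B.powerset, if X ∈ C then
        k X * ((-1 : ℤ) ^ (B \ C).card • (∑ X ∈ C, k X) ^ n) else 0 := by
    rw [Finset.sum_comm]
    refine Finset.sum_congr rfl fun C hC => ?_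
    rw [← Finset.sum_filter, Finset.filter_mem_eq_inter,
      Finset.inter_eq_right.2 (Finset.mem_powerset.1 hC), Finset.empty_union]
    simp only [pow_succ', Finset.sum_mul, Finset.smul_sum, mul_smul_comm]
  rw [h1]
  refine Finset.sum_congr rfl fun X hX => ?_
  rw [alternatingSum_add_erase _ hX, Finset.insert_empty]
  unfold alternatingSum
  conv_lhs => rw [← Finset.insert_erase hX]
  rw [Finset.sum_powerset_insert (Finset.notMem_erase X B), Finset.mul_sum]
  have h2 : (∑ C ∈ (B.erase X).powerset, if X ∈ C then
      k X * ((-1 : ℤ) ^ (insert X (B.erase X) \ C).card • (∑ X ∈ C, k X) ^ n) else 0) = 0 := by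
    refine Finset.sum_eq_zero fun C hC => if_neg fun h => ?_
    exact Finset.notMem_erase X B (Finset.mem_powerset.1 hC h)
  rw [h2, zero_add]
  refine Finset.sum_congr rfl fun C hC => ?_
  rw [if_pos (Finset.mem_insert_self _ _), Finset.insert_sdiff_insert,
    Finset.sdiff_insert_of_notMem (Finset.notMem_erase X B), ← Finset.insert_eq]

lemma alternatingSum_pow_zero {R : Type*} [Ring R] (k : ι → R) (B : Finset ι) :
    alternatingSum (fun A => (∑ X ∈ A, k X) ^ 0) B ∅ = if B = ∅ then 1 else 0 := by
  rcases B.eq_empty_or_nonempty with rfl | ⟨X, hX⟩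
  · simp
  · rw [if_neg (Finset.ne_empty_of_mem hX), ← Finset.insert_erase hX,
      alternatingSum_insert _ (Finset.notMem_erase X B)]
    simp [alternatingSum]

lemma norm_alternatingSum_pow_le {R : Type*} [NormedRing R] (h1 : ‖(1 : R)‖ ≤ 1) {k : ι → R}
    {r : ℝ} (hr : 0 ≤ r) (hk : ∀ X, ‖k X‖ ≤ r) (n : ℕ) (B : Finset ι) :
    ‖alternatingSum (fun A => (∑ X ∈ A, k X) ^ n) B ∅‖ ≤
      alternatingSum (fun A => (∑ _X ∈ A, r) ^ n) B ∅ := by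
  induction n generalizing B with
  | zero =>
    rw [alternatingSum_pow_zero, alternatingSum_pow_zero]
    split_ifs
    · exact h1
    · simp
  | succ n ih =>
    rw [alternatingSum_pow_succ, alternatingSum_pow_succ]
    refine norm_sum_le_of_le _ fun X _ => (norm_mul_le _ _).trans ?_
    gcongr
    · exact hk X
    · exact (norm_add_le _ _).trans (add_le_add (ih _) (ih _))

lemma alternatingSum_prod (y : ℝ) (B : Finset ι) :
    alternatingSum (fun A => y ^ A.card) B ∅ = (y - 1) ^ B.card := by
  rw [← Finset.prod_const, sub_eq_add_neg, Finset.prod_add]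
  refine Finset.sum_congr rfl fun C _ => ?_
  simp [mul_comm]

lemma hasSum_alternatingSum_exp {R : Type*} [NormedRing R] [NormedAlgebra ℂ R] [CompleteSpace R]
    (k : ι → R) (B : Finset ι) :
    HasSum (fun n : ℕ => ((n.factorial : ℂ)⁻¹) • alternatingSum (fun A => (∑ X ∈ A, k X) ^ n) B ∅)
      (alternatingSum (fun A => NormedSpace.exp (∑ X ∈ A, k X)) B ∅) := by
  unfold alternatingSum
  simp_rw [Finset.smul_sum, smul_comm _ ((-1 : ℤ) ^ _)]
  refine hasSum_sum fun C _ => HasSum.const_smul _ ?_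
  exact NormedSpace.exp_series_hasSum_exp' _

/-- In the exponential series of `∑ X ∈ B, k X`, the words in which all letters occur sum up to at
most `(e ^ r - 1) ^ |B|`. -/
theorem norm_alternatingSum_exp_le {R : Type*} [NormedRing R] [NormedAlgebra ℂ R]
    [CompleteSpace R] (h1 : ‖(1 : R)‖ ≤ 1) {k : ι → R} {r : ℝ} (hr : 0 ≤ r)
    (hk : ∀ X, ‖k X‖ ≤ r) (B : Finset ι) :
    ‖alternatingSum (fun A => NormedSpace.exp (∑ X ∈ A, k X)) B ∅‖ ≤
      (Real.exp r - 1) ^ B.card := by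
  have h2 : HasSum (fun n : ℕ => ((n.factorial : ℝ)⁻¹) *
      alternatingSum (fun A => (∑ _X ∈ A, r) ^ n) B ∅) ((Real.exp r - 1) ^ B.card) := by
    rw [← alternatingSum_prod]
    unfold alternatingSum
    simp_rw [Finset.mul_sum, mul_smul_comm]
    refine hasSum_sum fun C _ => HasSum.const_smul _ ?_
    rw [← Real.exp_nat_mul, Real.exp_eq_exp_ℝ]
    simpa using NormedSpace.exp_series_hasSum_exp' (𝕂 := ℝ) ((∅ ∪ C).card * r)
  refine (hasSum_alternatingSum_exp k B).norm_le_of_bounded h2 fun n => ?_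
  rw [norm_smul, norm_inv, Complex.norm_natCast]
  gcongr
  exact norm_alternatingSum_pow_le h1 hr hk n B

end AlternatingExp

/-! ### Expectations in a product state -/

section State

open scoped Matrix.Norms.L2Operator MatrixOrder

variable {n : Type*} [Fintype n] [DecidableEq n]

lemma opNorm_eq_norm {V : Type*} [Fintype V] [DecidableEq V] {d : ℕ} (A : Op V d) :
    opNorm A = ‖A‖ := (Matrix.cstar_norm_def A).symm

/-- `|tr (A ρ)| ≤ ‖A‖ tr ρ` for `ρ = Bᴴ B`. -/
lemma norm_trace_mul_conjTranspose_mul_le (A B : Matrix n n ℂ) :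
    ‖(A * (B.conjTranspose * B)).trace‖ ≤ ‖A‖ * (B.conjTranspose * B).trace.re := by
  set v : n → EuclideanSpace ℂ n := fun i => WithLp.toLp 2 fun j => star (B i j) with hv
  have h1 : (A * (B.conjTranspose * B)).trace =
      ∑ i, inner ℂ (v i) (Matrix.toEuclideanCLM (𝕜 := ℂ) A (v i)) := by
    rw [← Matrix.mul_assoc, Matrix.trace_mul_comm, Matrix.trace]
    refine Finset.sum_congr rfl fun i _ => ?_
    simp only [Matrix.diag_apply, Matrix.mul_apply, hv, PiLp.inner_apply,
      Matrix.toEuclideanCLM_toLp, Matrix.mulVec, dotProduct, RCLike.inner_apply,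
      Matrix.conjTranspose_apply, starRingEnd_apply, star_star]
    exact Finset.sum_congr rfl fun j _ => mul_comm _ _
  have h2 : (B.conjTranspose * B).trace.re = ∑ i, ‖v i‖ ^ 2 := by
    rw [Matrix.trace_mul_comm, Matrix.trace, Complex.re_sum]
    refine Finset.sum_congr rfl fun i _ => ?_
    simp [EuclideanSpace.norm_sq_eq, hv, Matrix.mul_apply, Complex.mul_conj,
      Complex.normSq_eq_norm_sq, -Complex.ofReal_pow]
  rw [h1, h2, Finset.mul_sum]
  refine norm_sum_le_of_le _ fun i _ => (norm_inner_le_norm _ _).trans ?_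
  have := (Matrix.toEuclideanCLM (𝕜 := ℂ) A).le_opNorm (v i)
  rw [← Matrix.cstar_norm_def] at this
  nlinarith [norm_nonneg (v i)]

variable {V : Type*} [Fintype V] [DecidableEq V] {d : ℕ}

lemma IsProductState.exists_conjTranspose_mul {ρ : Op V d} (hρ : IsProductState ρ) :
    ∃ B : Op V d, ρ = B.conjTranspose * B := by
  obtain ⟨r, hr, hρ⟩ := hρ
  have : ∀ v, ∃ b : Matrix (Fin d) (Fin d) ℂ, r v = b.conjTranspose * b := fun v =>
    CStarAlgebra.nonneg_iff_eq_star_mul_self.mp (hr v).1.nonneg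
  choose b hb using this
  refine ⟨Matrix.of fun σ τ => ∏ v, b v (σ v) (τ v), ?_⟩
  ext σ τ
  rw [hρ, Matrix.mul_apply]
  simp only [Matrix.conjTranspose_apply, Matrix.of_apply, star_prod, ← Finset.prod_mul_distrib]
  rw [← Fintype.piFinset_univ, ← Finset.prod_univ_sum (fun _ => Finset.univ)
    (fun v k => star (b v k (σ v)) * b v k (τ v))]
  refine Finset.prod_congr rfl fun v _ => ?_
  rw [hb, Matrix.mul_apply]
  simp only [Matrix.conjTranspose_apply]

lemma IsProductState.trace_eq_one {ρ : Op V d} (hρ : IsProductState ρ) : ρ.trace = 1 := by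
  obtain ⟨r, hr, hρ⟩ := hρ
  simp only [Matrix.trace, Matrix.diag_apply, hρ]
  rw [← Fintype.piFinset_univ, ← Finset.prod_univ_sum (fun _ => Finset.univ)
    (fun v k => r v k k)]
  exact Finset.prod_eq_one fun v _ => (hr v).2

lemma IsProductState.norm_trace_mul_le {ρ : Op V d} (hρ : IsProductState ρ) (A : Op V d) :
    ‖(A * ρ).trace‖ ≤ ‖A‖ := by
  obtain ⟨B, hB⟩ := hρ.exists_conjTranspose_mul
  have := norm_trace_mul_conjTranspose_mul_le A B
  rwa [← hB, hρ.trace_eq_one, Complex.one_re, mul_one] at this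


/-! ### Operators on complementary sets of spins -/

/-- The configurations of `V` as pairs of configurations of `U` and of its complement. -/
def splitConfig (d : ℕ) (U : Finset V) :
    (V → Fin d) ≃ ({v // v ∈ U} → Fin d) × ({v // v ∉ U} → Fin d) :=
  Equiv.piEquivPiSubtypeProd (· ∈ U) fun _ => Fin d

open scoped Kronecker in
/-- `P ↦ P ⊗ 1` for operators on the spins in `U`. -/
def liftInside (U : Finset V) :
    Matrix ({v // v ∈ U} → Fin d) ({v // v ∈ U} → Fin d) ℂ →ₐ[ℂ] Op V d where
  toFun P := (P ⊗ₖ (1 : Matrix ({v // v ∉ U} → Fin d) ({v // v ∉ U} → Fin d) ℂ)).submatrix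
    (splitConfig d U) (splitConfig d U)
  map_one' := by simp
  map_zero' := by simp
  map_add' P Q := by rw [Matrix.add_kronecker]; rfl
  map_mul' P Q := by
    rw [Matrix.submatrix_mul_equiv, ← Matrix.mul_kronecker_mul, one_mul]
  commutes' c := by
    simp only [Algebra.algebraMap_eq_smul_one, Matrix.smul_kronecker, Matrix.submatrix_smul]
    simp

open scoped Kronecker in
/-- `Q ↦ 1 ⊗ Q` for operators on the spins outside `U`. -/
def liftOutside (U : Finset V) :
    Matrix ({v // v ∉ U} → Fin d) ({v // v ∉ U} → Fin d) ℂ →ₐ[ℂ] Op V d where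
  toFun P := ((1 : Matrix ({v // v ∈ U} → Fin d) ({v // v ∈ U} → Fin d) ℂ) ⊗ₖ P).submatrix
    (splitConfig d U) (splitConfig d U)
  map_one' := by simp
  map_zero' := by simp
  map_add' P Q := by rw [Matrix.kronecker_add]; rfl
  map_mul' P Q := by
    rw [Matrix.submatrix_mul_equiv, ← Matrix.mul_kronecker_mul, one_mul]
  commutes' c := by
    simp only [Algebra.algebraMap_eq_smul_one, Matrix.kronecker_smul, Matrix.submatrix_smul]
    simp

lemma ActsOn.exists_liftInside {A : Op V d} {X U : Finset V} (hA : ActsOn A X) (hX : X ⊆ U) :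
    ∃ P, A = liftInside U P := by
  obtain ⟨B, hB⟩ := hA
  refine ⟨Matrix.of fun σ τ => if ∀ v, v.1 ∉ X → σ v = τ v then
    B (fun v => σ ⟨v, hX v.2⟩) (fun v => τ ⟨v, hX v.2⟩) else 0, ?_⟩
  ext σ τ
  rw [hB]
  simp only [liftInside, AlgHom.coe_mk, RingHom.coe_mk, MonoidHom.coe_mk, OneHom.coe_mk,
    Matrix.submatrix_apply, Matrix.kroneckerMap_apply, Matrix.of_apply, Matrix.one_apply,
    splitConfig, Equiv.piEquivPiSubtypeProd_apply, mul_ite, mul_one, mul_zero,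
    funext_iff, Subtype.forall]
  rw [← ite_and]
  refine if_congr ⟨fun h => ⟨fun v hv => h v fun h' => hv (hX h'), fun v _ hv => h v hv⟩,
    fun h v hv => ?_⟩ rfl rfl
  by_cases hvU : v ∈ U
  · exact h.2 v hvU hv
  · exact h.1 v hvU

lemma ActsOn.exists_liftOutside {A : Op V d} {X U : Finset V} (hA : ActsOn A X)
    (hX : Disjoint U X) : ∃ P, A = liftOutside U P := by
  obtain ⟨B, hB⟩ := hA
  have hX' : ∀ v ∈ X, v ∉ U := fun v h h' => Finset.disjoint_left.1 hX h' h
  refine ⟨Matrix.of fun σ τ => if ∀ v, v.1 ∉ X → σ v = τ v then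
    B (fun v => σ ⟨v, hX' v v.2⟩) (fun v => τ ⟨v, hX' v v.2⟩) else 0, ?_⟩
  ext σ τ
  rw [hB]
  simp only [liftOutside, AlgHom.coe_mk, RingHom.coe_mk, MonoidHom.coe_mk, OneHom.coe_mk,
    Matrix.submatrix_apply, Matrix.kroneckerMap_apply, Matrix.of_apply, Matrix.one_apply,
    splitConfig, Equiv.piEquivPiSubtypeProd_apply, ite_mul, mul_ite, one_mul, mul_zero, zero_mul,
    funext_iff, Subtype.forall]
  rw [← ite_and]
  refine if_congr ⟨fun h => ⟨fun v _ hv => h v hv, fun v hv => h v fun h' => hX' v h' hv⟩,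
    fun h v hv => ?_⟩ rfl rfl
  by_cases hvU : v ∈ U
  · exact h.2 v hvU
  · exact h.1 v hvU hv

lemma actsOn_liftInside (U : Finset V)
    (P : Matrix ({v // v ∈ U} → Fin d) ({v // v ∈ U} → Fin d) ℂ) : ActsOn (liftInside U P) U := by
  refine ⟨P, fun σ τ => ?_⟩
  simp only [liftInside, AlgHom.coe_mk, RingHom.coe_mk, MonoidHom.coe_mk, OneHom.coe_mk,
    Matrix.submatrix_apply, Matrix.kroneckerMap_apply, Matrix.one_apply,
    splitConfig, Equiv.piEquivPiSubtypeProd_apply, mul_ite, mul_one, mul_zero,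
    funext_iff, Subtype.forall]

lemma ActsOn.smul {A : Op V d} {X : Finset V} (hA : ActsOn A X) (c : ℂ) : ActsOn (c • A) X := by
  obtain ⟨P, rfl⟩ := hA.exists_liftInside subset_rfl
  rw [← map_smul]
  exact actsOn_liftInside X _

lemma ActsOn.sum {ι : Type*} {A : ι → Op V d} {X : ι → Finset V} {U : Finset V} {s : Finset ι}
    (hA : ∀ i ∈ s, ActsOn (A i) (X i)) (hX : ∀ i ∈ s, X i ⊆ U) : ActsOn (∑ i ∈ s, A i) U := by
  classical
  have : ∀ i, ∃ P, i ∈ s → A i = liftInside U P := fun i => by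
    by_cases hi : i ∈ s
    · obtain ⟨P, hP⟩ := (hA i hi).exists_liftInside (hX i hi)
      exact ⟨P, fun _ => hP⟩
    · exact ⟨0, fun h => absurd h hi⟩
  choose P hP using this
  rw [Finset.sum_congr rfl hP, ← map_sum]
  exact actsOn_liftInside U _

open scoped Kronecker in
lemma IsProductState.exists_kronecker {ρ : Op V d} (hρ : IsProductState ρ) (U : Finset V) :
    ∃ (ρ₁ : Matrix ({v // v ∈ U} → Fin d) ({v // v ∈ U} → Fin d) ℂ)
      (ρ₂ : Matrix ({v // v ∉ U} → Fin d) ({v // v ∉ U} → Fin d) ℂ),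
      ρ₁.trace = 1 ∧ ρ₂.trace = 1 ∧
        ρ = (ρ₁ ⊗ₖ ρ₂).submatrix (splitConfig d U) (splitConfig d U) := by
  obtain ⟨r, hr, hρ⟩ := hρ
  have h1 : ∀ p : V → Prop, ∀ [Fintype {v // p v}] [DecidablePred p], IsProductState
      (Matrix.of fun σ τ : {v // p v} → Fin d => ∏ v : {v // p v}, r v (σ v) (τ v)) :=
    fun p _ _ => ⟨fun v => r v, fun v => hr v, fun σ τ => rfl⟩
  refine ⟨_, _, (h1 (· ∈ U)).trace_eq_one, (h1 (· ∉ U)).trace_eq_one, ?_⟩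
  ext σ τ
  rw [hρ, ← Fintype.prod_subtype_mul_prod_subtype (· ∈ U)]
  simp only [Matrix.submatrix_apply, Matrix.kroneckerMap_apply, Matrix.of_apply, splitConfig,
    Equiv.piEquivPiSubtypeProd_apply]
  convert rfl

/-- Expectations of exponentials of operators on disjoint sets of spins factorize in a product
state. -/
theorem IsProductState.trace_exp_add_mul {ρ : Op V d} (hρ : IsProductState ρ) {X Y : Finset V}
    (hXY : Disjoint X Y) {A B : Op V d} (hA : ActsOn A X) (hB : ActsOn B Y) :
    (NormedSpace.exp (A + B) * ρ).trace =
      (NormedSpace.exp A * ρ).trace * (NormedSpace.exp B * ρ).trace := by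
  obtain ⟨P, rfl⟩ := hA.exists_liftInside subset_rfl
  obtain ⟨Q, rfl⟩ := hB.exists_liftOutside hXY
  obtain ⟨ρ₁, ρ₂, h1, h2, rfl⟩ := hρ.exists_kronecker X
  have hPQ : ∀ P Q, liftInside (d := d) X P * liftOutside X Q =
      (P.kronecker Q).submatrix (splitConfig d X) (splitConfig d X) := by
    intro P Q
    change (_ : Matrix _ _ ℂ).submatrix _ _ * (_ : Matrix _ _ ℂ).submatrix _ _ = _
    rw [Matrix.submatrix_mul_equiv, ← Matrix.mul_kronecker_mul, one_mul, mul_one]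
    rfl
  have hQP : ∀ P Q, liftOutside (d := d) X Q * liftInside X P =
      (P.kronecker Q).submatrix (splitConfig d X) (splitConfig d X) := by
    intro P Q
    change (_ : Matrix _ _ ℂ).submatrix _ _ * (_ : Matrix _ _ ℂ).submatrix _ _ = _
    rw [Matrix.submatrix_mul_equiv, ← Matrix.mul_kronecker_mul, one_mul, mul_one]
    rfl
  have hc : Commute (liftInside (d := d) X P) (liftOutside X Q) := (hPQ P Q).trans (hQP P Q).symm
  have e1 : NormedSpace.exp (liftInside (d := d) X P) = liftInside X (NormedSpace.exp P) := by
    let := NormedAlgebra.restrictScalars ℚ ℂ (Matrix ({v // v ∈ X} → Fin d)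
      ({v // v ∈ X} → Fin d) ℂ)
    exact (NormedSpace.map_exp (liftInside X) (LinearMap.continuous_of_finiteDimensional
      (liftInside (d := d) X).toLinearMap) P).symm
  have e2 : NormedSpace.exp (liftOutside (d := d) X Q) = liftOutside X (NormedSpace.exp Q) := by
    let := NormedAlgebra.restrictScalars ℚ ℂ (Matrix ({v // v ∉ X} → Fin d)
      ({v // v ∉ X} → Fin d) ℂ)
    exact (NormedSpace.map_exp (liftOutside X) (LinearMap.continuous_of_finiteDimensional
      (liftOutside (d := d) X).toLinearMap) Q).symm
  have hT : ∀ P Q, (liftInside (d := d) X P * liftOutside X Q *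
      (ρ₁.kronecker ρ₂).submatrix (splitConfig d X) (splitConfig d X)).trace =
        (P * ρ₁).trace * (Q * ρ₂).trace := by
    intro P Q
    rw [hPQ, Matrix.submatrix_mul_equiv, ← Matrix.trace_kronecker, Matrix.mul_kronecker_mul]
    exact Equiv.sum_comp (splitConfig d X) fun i => (P.kronecker Q * ρ₁.kronecker ρ₂) i i
  have hP := hT (NormedSpace.exp P) 1
  have hQ := hT 1 (NormedSpace.exp Q)
  rw [map_one, mul_one, one_mul, h2, mul_one] at hP
  rw [map_one, one_mul, one_mul, h1, one_mul] at hQ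
  rw [Matrix.exp_add_of_commute _ _ hc, e1, e2]
  exact (hT _ _).trans (congrArg₂ (· * ·) hP.symm hQ.symm)

end State

/-! ### The logarithm on the disc -/

section PartitionFunction

open scoped Matrix.Norms.L2Operator

variable {V : Type*} [Fintype V] [DecidableEq V] {d : ℕ} {S : Finset (Finset V)}

/-- `tr (e^K ρ)` with `K = ∑_{X ∈ A} z_X h_X`. The factor `-it` is absorbed into `z`. -/
noncomputable def partialPartition (h : S → Op V d) (ρ : Op V d) (z : S → ℂ) (A : Finset S) : ℂ :=
  (NormedSpace.exp (∑ X ∈ A, z X • h X) * ρ).trace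

variable {h : S → Op V d} {ρ : Op V d}

lemma partialPartition_empty (hρ : IsProductState ρ) (z : S → ℂ) :
    partialPartition h ρ z ∅ = 1 := by
  simp [partialPartition, NormedSpace.exp_zero, hρ.trace_eq_one]

lemma loschmidt_eq_partialPartition (l : S → ℝ) (t : ℂ) :
    loschmidt h ρ l t =
      partialPartition h ρ (fun X => t * (-Complex.I * (l X : ℂ))) Finset.univ := by
  unfold loschmidt partialPartition hamiltonian
  rw [Finset.smul_sum]
  congr 4 with X : 1
  rw [smul_smul]
  congr 1
  ring

/-- The partition function factorizes over families of subsystems that do not overlap. -/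
lemma partialPartition_eq_mul (hρ : IsProductState ρ) (hh : ∀ X, ActsOn (h X) X.1)
    (z w : S → ℂ) {A B : Finset S} (hAB : ∀ X ∈ A, ∀ Y ∈ B, Disjoint X.1 Y.1) :
    (NormedSpace.exp (∑ X ∈ A, z X • h X + ∑ Y ∈ B, w Y • h Y) * ρ).trace =
      partialPartition h ρ z A * partialPartition h ρ w B := by
  refine hρ.trace_exp_add_mul (X := A.biUnion fun X => X.1) (Y := B.biUnion fun Y => Y.1) ?_ ?_ ?_
  · simpa only [Finset.disjoint_biUnion_left, Finset.disjoint_biUnion_right] using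
      fun X hX Y hY => hAB Y hY X hX
  · exact ActsOn.sum (fun X _ => (hh X).smul _) fun X hX => Finset.subset_biUnion_of_mem _ hX
  · exact ActsOn.sum (fun X _ => (hh X).smul _) fun X hX => Finset.subset_biUnion_of_mem _ hX

lemma analyticAt_partialPartition (A : Finset S) (z : S → ℂ) :
    AnalyticAt ℂ (fun z => partialPartition h ρ z A) z := by
  let T : Op V d →L[ℂ] ℂ := LinearMap.toContinuousLinearMap
    ((Matrix.traceLinearMap (V → Fin d) ℂ ℂ).comp (LinearMap.mulRight ℂ ρ))
  have hT : (fun z => partialPartition h ρ z A) =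
      fun z : S → ℂ => T (NormedSpace.exp (∑ X ∈ A, z X • h X)) := rfl
  rw [hT]
  refine (T.analyticAt _).comp ((NormedSpace.exp_analytic (𝕂 := ℂ) _).comp
    (f := fun z : S → ℂ => ∑ X ∈ A, z X • h X) ?_)
  refine Finset.analyticAt_fun_sum _ fun X _ => ?_
  exact ((ContinuousLinearMap.proj (R := ℂ) (φ := fun _ : S => ℂ) X).analyticAt z).smul
    analyticAt_const

lemma norm_alternatingSum_partialPartition_le (hρ : IsProductState ρ)
    (h_norm : ∀ X, opNorm (h X) = 1) {z : S → ℂ} {r : ℝ} (hr : 0 ≤ r) (hz : ∀ X, ‖z X‖ ≤ r)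
    (B : Finset S) :
    ‖alternatingSum (partialPartition h ρ z) B ∅‖ ≤ (Real.exp r - 1) ^ B.card := by
  have h1 : alternatingSum (partialPartition h ρ z) B ∅ =
      (alternatingSum (fun A => NormedSpace.exp (∑ X ∈ A, z X • h X)) B ∅ * ρ).trace := by
    simp only [alternatingSum, partialPartition, Finset.sum_mul, Matrix.trace_sum, smul_mul_assoc,
      Matrix.trace_smul]
  rw [h1]
  refine (hρ.norm_trace_mul_le _).trans (norm_alternatingSum_exp_le ?_ hr (fun X => ?_) B)
  · rw [Matrix.cstar_norm_def, map_one]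
    exact ContinuousLinearMap.norm_id_le
  · rw [norm_smul, ← opNorm_eq_norm, h_norm, mul_one]
    exact hz X

/-- With `x = e^r - 1` and `β = 1 + 1/D`, the bound `β ^ D ≤ e` leaves room in both conditions of
the exploration estimate. -/
lemma exploration_constants {D : ℕ} (hD : 1 ≤ D) {r : ℝ} (hr : 0 ≤ r) (hrD : r < loschmidtTime D) :
    (Real.exp r - 1) * (1 + 1 / (D : ℝ)) ^ D ≤ 1 / 4 ∧
      1 + (Real.exp r - 1) * (1 + 1 / (D : ℝ)) ^ D ≤
        (1 + 1 / (D : ℝ)) * (1 - (Real.exp r - 1) * (1 + 1 / (D : ℝ)) ^ D) := by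
  have hD' : (1 : ℝ) ≤ D := by exact_mod_cast hD
  have he := Real.exp_one_gt_d9
  have hβ : (1 + 1 / (D : ℝ)) ^ D ≤ Real.exp 1 := by
    calc (1 + 1 / (D : ℝ)) ^ D ≤ Real.exp (1 / D) ^ D := by
          gcongr
          linarith [Real.add_one_le_exp (1 / (D : ℝ))]
      _ = Real.exp 1 := by
          rw [← Real.exp_nat_mul]
          congr 1
          field_simp
  have hr1 : r * (2 * Real.exp 1 ^ 2 * D * (D + 1)) < 1 := by
    rwa [loschmidtTime, lt_div_iff₀ (by positivity)] at hrD
  have hDD : 2 ≤ (D : ℝ) * (D + 1) := by nlinarith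
  have hrle : r ≤ 1 := by
    by_contra! hlt
    nlinarith [mul_le_mul hDD (show (1 : ℝ) ≤ Real.exp 1 ^ 2 by nlinarith) zero_le_one
      (by positivity)]
  have hx : Real.exp r - 1 ≤ 2 * r := by
    have := Real.abs_exp_sub_one_le (x := r) (by rwa [abs_of_nonneg hr])
    rw [abs_of_nonneg hr] at this
    exact (le_abs_self _).trans this
  have hx0 : 0 ≤ Real.exp r - 1 := by linarith [Real.add_one_le_exp r]
  set ε := (Real.exp r - 1) * (1 + 1 / (D : ℝ)) ^ D with hε
  have hε0 : 0 ≤ ε := by positivity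
  have hε1 : ε ≤ 2 * r * Real.exp 1 := mul_le_mul hx hβ (by positivity) (by positivity)
  have hε2 : ε * (2 * (D * (D + 1))) ≤ 1 := by
    have : ε * (Real.exp 1 * (D * (D + 1))) ≤ 1 := by
      calc _ ≤ 2 * r * Real.exp 1 * (Real.exp 1 * (D * (D + 1))) := by gcongr
        _ = r * (2 * Real.exp 1 ^ 2 * D * (D + 1)) := by ring
        _ ≤ 1 := hr1.le
    refine le_trans ?_ this
    gcongr
    linarith
  refine ⟨by nlinarith, ?_⟩
  have h3 : ε * (2 * D + 1) ≤ 1 := le_trans (by gcongr; nlinarith) hε2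
  have h4 : (1 + 1 / (D : ℝ)) * (1 - ε) - (1 + ε) = (1 - ε * (2 * D + 1)) / D := by
    field_simp
    ring
  have : 0 ≤ (1 - ε * (2 * D + 1)) / (D : ℝ) := div_nonneg (by linarith) (by linarith)
  linarith

open Classical in
omit [Fintype V] in
lemma card_filter_adj_le (Y : S) (A : Finset S) :
    (A.filter ((interactionGraph S).Adj Y)).card ≤ maxDeg S := by
  refine le_trans ?_ ((interactionGraph S).degree_le_maxDegree Y)
  rw [← SimpleGraph.card_neighborFinset_eq_degree]
  refine Finset.card_le_card fun Z hZ => ?_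
  rw [SimpleGraph.mem_neighborFinset]
  exact (Finset.mem_filter.1 hZ).2

/-- The exploration estimate for the partition function. -/
lemma partialPartition_ratio (hS : 1 ≤ maxDeg S) (hρ : IsProductState ρ)
    (hh : ∀ X, ActsOn (h X) X.1) (h_norm : ∀ X, opNorm (h X) = 1) {z : S → ℂ} {r : ℝ}
    (hr : 0 ≤ r) (hrD : r < loschmidtTime (maxDeg S)) (hz : ∀ X, ‖z X‖ ≤ r) (A : Finset S) :
    partialPartition h ρ z A ≠ 0 ∧ ∀ Y ∉ A,
      ‖partialPartition h ρ z (insert Y A) / partialPartition h ρ z A - 1‖ ≤ 1 / 4 := by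
  classical
  obtain ⟨h1, h2⟩ := exploration_constants hS hr hrD
  have hx : 0 ≤ Real.exp r - 1 := by linarith [Real.add_one_le_exp r]
  have hβ : 1 ≤ 1 + 1 / (maxDeg S : ℝ) := by linarith [show 0 ≤ 1 / (maxDeg S : ℝ) by positivity]
  have hmul : ∀ A B : Finset S, Disjoint A B →
      (∀ X ∈ B, ∀ Y ∈ A, ¬ (interactionGraph S).Adj X Y) →
      partialPartition h ρ z (A ∪ B) = partialPartition h ρ z A * partialPartition h ρ z B := by
    intro A B hAB hadj
    rw [← partialPartition_eq_mul hρ hh, partialPartition, Finset.sum_union hAB]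
    intro X hX Y hY
    by_contra hne
    refine hadj Y hY X hX ⟨fun e => Finset.disjoint_left.1 hAB hX (e ▸ hY), ?_⟩
    rwa [Finset.inter_comm, ← Finset.not_disjoint_iff_nonempty_inter]
  have hB := norm_alternatingSum_partialPartition_le hρ h_norm hr hz
  exact ⟨(exploration_bound (partialPartition_empty hρ z) hmul
      (fun Y A _ => card_filter_adj_le Y A) hx hβ hB (by linarith) h2 A).1,
    fun Y hY => (norm_insert_div_sub_one_le (partialPartition_empty hρ z) hmul
      (fun Y A _ => card_filter_adj_le Y A) hx hβ hB (by linarith) h2 hY).trans h1⟩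

/-- A logarithm of the partition function, as a sum of principal logarithms of ratios. Each ratio
lies within `1/4` of `1`, so each summand has modulus at most `3/8`. -/
theorem exists_log_partialPartition (hS : 1 ≤ maxDeg S) (hρ : IsProductState ρ)
    (hh : ∀ X, ActsOn (h X) X.1) (h_norm : ∀ X, opNorm (h X) = 1) {c : S → ℂ}
    (hc : ∀ X, ‖c X‖ ≤ 1) (A : Finset S) :
    ∃ g : ℂ → ℂ, g 0 = 0 ∧
      AnalyticOnNhd ℂ g (Metric.ball 0 (loschmidtTime (maxDeg S))) ∧
      ∀ t ∈ Metric.ball (0 : ℂ) (loschmidtTime (maxDeg S)),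
        Complex.exp (g t) = partialPartition h ρ (fun X => t * c X) A ∧ ‖g t‖ ≤ A.card := by
  classical
  have hratio : ∀ t ∈ Metric.ball (0 : ℂ) (loschmidtTime (maxDeg S)), ∀ A : Finset S,
      partialPartition h ρ (fun X => t * c X) A ≠ 0 ∧ ∀ Y ∉ A,
      ‖partialPartition h ρ (fun X => t * c X) (insert Y A) /
        partialPartition h ρ (fun X => t * c X) A - 1‖ ≤ 1 / 4 := fun t ht A =>
    partialPartition_ratio hS hρ hh h_norm (norm_nonneg t) (mem_ball_zero_iff.1 ht)
      (fun X => by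
        rw [norm_mul]
        exact mul_le_of_le_one_right (norm_nonneg t) (hc X)) A
  have hana : ∀ (A : Finset S) (t : ℂ),
      AnalyticAt ℂ (fun t => partialPartition h ρ (fun X => t * c X) A) t := fun A t =>
    (analyticAt_partialPartition A _).comp (f := fun t X => t * c X)
      (analyticAt_pi_iff.2 fun X => analyticAt_id.mul analyticAt_const)
  induction A using Finset.induction_on with
  | empty =>
    refine ⟨0, rfl, analyticOnNhd_const, fun t _ => ?_⟩
    simp [partialPartition_empty hρ]
  | insert Y A hY ih =>
    obtain ⟨g, hg0, hga, hg⟩ := ih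
    set q : ℂ → ℂ := fun t => partialPartition h ρ (fun X => t * c X) (insert Y A) /
      partialPartition h ρ (fun X => t * c X) A with hq
    have hslit : ∀ t ∈ Metric.ball (0 : ℂ) (loschmidtTime (maxDeg S)), q t ∈ Complex.slitPlane := by
      intro t ht
      have h1 := (hratio t ht A).2 Y hY
      refine Complex.mem_slitPlane_of_norm_lt_one (z := q t - 1) (by linarith) |> fun h => ?_
      simpa using h
    refine ⟨fun t => g t + Complex.log (q t), ?_, fun t ht => (hga t ht).add ?_, fun t ht => ?_⟩
    · simp [hg0, hq, partialPartition, NormedSpace.exp_zero, hρ.trace_eq_one]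
    · exact ((hana _ t).div (hana _ t) (hratio t ht A).1).clog (hslit t ht)
    · obtain ⟨h1, h2⟩ := hg t ht
      have hA := (hratio t ht A).1
      have hqt : q t ≠ 0 := Complex.slitPlane_ne_zero (hslit t ht)
      refine ⟨?_, ?_⟩
      · rw [Complex.exp_add, h1, Complex.exp_log hqt, hq]
        field_simp
      · have h3 := (hratio t ht A).2 Y hY
        have h4 := Complex.norm_log_one_add_half_le_self (z := q t - 1) (by linarith)
        rw [add_sub_cancel] at h4
        rw [Finset.card_insert_of_notMem hY]
        push_cast
        refine (norm_add_le _ _).trans ?_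
        have h5 : ‖q t - 1‖ ≤ 1 / 4 := h3
        linarith

end PartitionFunction

section Tail

open Filter Topology

/-- Cauchy's estimate on an open disc, by letting the radius of the circle tend to `R`. -/
lemma norm_iteratedDeriv_mul_pow_le {g : ℂ → ℂ} {R C : ℝ} (hR : 0 < R)
    (hg : DifferentiableOn ℂ g (Metric.ball 0 R)) (hC : ∀ t ∈ Metric.ball (0 : ℂ) R, ‖g t‖ ≤ C)
    (m : ℕ) : ‖iteratedDeriv m g 0‖ * R ^ m ≤ m.factorial * C := by
  have h1 : ∀ r ∈ Set.Ioo 0 R, ‖iteratedDeriv m g 0‖ * r ^ m ≤ m.factorial * C := by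
    intro r hr
    have := Complex.norm_iteratedDeriv_le_of_forall_mem_sphere_norm_le m hr.1
      (c := 0) (f := g) (C := C)
      ((hg.mono (Metric.closedBall_subset_ball hr.2)).diffContOnCl_ball subset_rfl)
      fun z hz => hC z (Metric.sphere_subset_closedBall.trans
        (Metric.closedBall_subset_ball hr.2) hz)
    rwa [le_div_iff₀ (pow_pos hr.1 m)] at this
  have h2 : Tendsto (fun r : ℝ => ‖iteratedDeriv m g 0‖ * r ^ m) (𝓝[<] R)
      (𝓝 (‖iteratedDeriv m g 0‖ * R ^ m)) :=
    (Continuous.tendsto (by fun_prop) R).mono_left nhdsWithin_le_nhds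
  exact le_of_tendsto h2 (by filter_upwards [Ioo_mem_nhdsLT hR] with r hr using h1 r hr)

/-- The tail of the Taylor series of a bounded analytic function on a disc. -/
theorem norm_sub_taylor_le {g : ℂ → ℂ} {R C : ℝ} (hR : 0 < R)
    (hg : DifferentiableOn ℂ g (Metric.ball 0 R)) (hC : ∀ t ∈ Metric.ball (0 : ℂ) R, ‖g t‖ ≤ C)
    {t : ℂ} (ht : ‖t‖ < R) (M : ℕ) :
    ‖g t - ∑ m ∈ Finset.range (M + 1), t ^ m / m.factorial * iteratedDeriv m g 0‖ ≤
      C * ((‖t‖ / R) ^ (M + 1) / (1 - ‖t‖ / R)) := by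
  have hs := Complex.hasSum_taylorSeries_on_ball (c := 0) (r := R) (f := g) (z := t)
    hg (mem_ball_zero_iff.2 ht)
  have hq : ‖t‖ / R < 1 := (div_lt_one hR).2 ht
  have hs2 := (hasSum_nat_add_iff' (M + 1)).2 hs
  have hs3 := ((hasSum_geometric_of_lt_one (by positivity) hq).mul_left (C * (‖t‖ / R) ^ (M + 1)))
  have h1 : g t - ∑ m ∈ Finset.range (M + 1), t ^ m / m.factorial * iteratedDeriv m g 0 =
      g t - ∑ n ∈ Finset.range (M + 1),
        ((n.factorial : ℂ))⁻¹ • (t - 0) ^ n • iteratedDeriv n g 0 := by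
    congr 1
    refine Finset.sum_congr rfl fun m _ => ?_
    simp only [sub_zero, smul_eq_mul]
    ring
  rw [h1, div_eq_mul_inv, ← mul_assoc]
  refine hs2.norm_le_of_bounded hs3 fun n => ?_
  have h2 := norm_iteratedDeriv_mul_pow_le hR hg hC (n + (M + 1))
  have h3 : (0 : ℝ) < (n + (M + 1)).factorial := by positivity
  simp only [norm_smul, sub_zero, norm_inv, Complex.norm_natCast, norm_pow]
  rw [mul_assoc, ← pow_add, add_comm (M + 1) n, div_pow, inv_mul_le_iff₀ h3, mul_div_assoc',
    mul_div_assoc', le_div_iff₀ (by positivity)]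
  calc _ = ‖t‖ ^ (n + (M + 1)) * (‖iteratedDeriv (n + (M + 1)) g 0‖ * R ^ (n + (M + 1))) := by ring
    _ ≤ ‖t‖ ^ (n + (M + 1)) * ((n + (M + 1)).factorial * C) := by gcongr
    _ = _ := by ring

end Tail

/-! ### Iterated derivatives and clusters -/

section Derivatives

open Filter Topology

variable {E F G : Type*} [NormedAddCommGroup E] [NormedSpace ℝ E] [NormedAddCommGroup F]
  [NormedSpace ℝ F] [NormedAddCommGroup G] [NormedSpace ℝ G] [CompleteSpace F]

lemma iteratedFDeriv_comp_continuousLinearMap {f : E → F} (T : G →L[ℝ] E) {x : G}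
    (hf : AnalyticAt ℝ f (T x)) (n : ℕ) :
    iteratedFDeriv ℝ n (f ∘ T) x =
      (iteratedFDeriv ℝ n f (T x)).compContinuousLinearMap fun _ => T := by
  have hs : IsOpen {y | AnalyticAt ℝ f y} := isOpen_analyticAt ℝ f
  have hs' : IsOpen (T ⁻¹' {y | AnalyticAt ℝ f y}) := hs.preimage T.continuous
  rw [← iteratedFDerivWithin_of_isOpen n hs' (show x ∈ T ⁻¹' {y | AnalyticAt ℝ f y} from hf),
    ← iteratedFDerivWithin_of_isOpen n hs hf]
  exact T.iteratedFDerivWithin_comp_right (n := n)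
    (fun y hy => (AnalyticAt.contDiffAt hy).contDiffWithinAt)
    hs.uniqueDiffOn hs'.uniqueDiffOn hf le_rfl

/-- If `f (T (u, v))` splits near `0` into a function of `u` and a function of `v`, the derivatives
of `f` that involve both kinds of directions vanish. -/
lemma iteratedFDeriv_eq_zero_of_separate {f : E → F} (T : G × G →L[ℝ] E)
    (hf : AnalyticAt ℝ f 0)
    (hsep : ∀ᶠ p in 𝓝 (0 : G × G), f (T p) = f (T (p.1, 0)) + f (T (0, p.2)))
    {n : ℕ} (w : Fin n → G × G) {i j : Fin n} (hi : (w i).2 = 0) (hj : (w j).1 = 0) :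
    iteratedFDeriv ℝ n f 0 (fun k => T (w k)) = 0 := by
  let Q₁ : G × G →L[ℝ] E :=
    T.comp ((ContinuousLinearMap.inl ℝ G G).comp (ContinuousLinearMap.fst ℝ G G))
  let Q₂ : G × G →L[ℝ] E :=
    T.comp ((ContinuousLinearMap.inr ℝ G G).comp (ContinuousLinearMap.snd ℝ G G))
  have hfT : ∀ Q : G × G →L[ℝ] E, AnalyticAt ℝ f (Q 0) := fun Q => by rwa [map_zero]
  have hder : ∀ Q : G × G →L[ℝ] E, iteratedFDeriv ℝ n (f ∘ Q) 0 w =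
      iteratedFDeriv ℝ n f 0 (fun k => Q (w k)) := fun Q => by
    rw [iteratedFDeriv_comp_continuousLinearMap Q (hfT Q), map_zero]
    rfl
  have hcd : ∀ Q : G × G →L[ℝ] E, ContDiffAt ℝ n (f ∘ Q) 0 := fun Q =>
    ((hfT Q).comp (Q.analyticAt 0)).contDiffAt
  have hsum : f ∘ T =ᶠ[𝓝 0] (f ∘ Q₁ + f ∘ Q₂) := hsep
  rw [← hder T, (hsum.iteratedFDeriv ℝ n).eq_of_nhds, iteratedFDeriv_add_apply (hcd _) (hcd _),
    _root_.add_apply, hder, hder,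
    ContinuousMultilinearMap.map_coord_zero _ j (by simp [Q₁, hj, ← Prod.zero_eq_mk]),
    ContinuousMultilinearMap.map_coord_zero _ i (by simp [Q₂, hi, ← Prod.zero_eq_mk]), add_zero]

/-- The iterated derivative along a line equals the complex derivative of a holomorphic function
with the same restriction. -/
lemma iteratedFDeriv_diagonal_eq {f : E → ℂ} (hf : AnalyticAt ℝ f 0) {g : ℂ → ℂ}
    (hg : AnalyticAt ℂ g 0) (x : E) (t : ℂ) (hfg : ∀ᶠ s : ℝ in 𝓝 0, f (s • x) = g (s * t)) (m : ℕ) :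
    iteratedFDeriv ℝ m f 0 (fun _ => x) = t ^ m * iteratedDeriv m g 0 := by
  let L : ℝ →L[ℝ] E := (ContinuousLinearMap.id ℝ ℝ).smulRight x
  let K : ℝ →L[ℝ] ℂ := (ContinuousLinearMap.id ℝ ℝ).smulRight t
  have h1 : iteratedFDeriv ℝ m (f ∘ L) 0 (fun _ => 1) = iteratedFDeriv ℝ m f 0 (fun _ => x) := by
    rw [iteratedFDeriv_comp_continuousLinearMap L (by rwa [map_zero]), map_zero]
    simp [L]
  have h2 : iteratedFDeriv ℝ m (g ∘ K) 0 (fun _ => 1) = iteratedFDeriv ℝ m g 0 (fun _ => t) := by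
    rw [iteratedFDeriv_comp_continuousLinearMap K (by rw [map_zero]; exact hg.restrictScalars),
      map_zero]
    simp [K]
  have h3 : f ∘ L =ᶠ[𝓝 0] g ∘ K := by
    filter_upwards [hfg] with s hs
    simpa [L, K] using hs
  rw [← h1, (h3.iteratedFDeriv ℝ m).eq_of_nhds, h2,
    ← (hg.contDiffAt (n := m)).restrictScalars_iteratedFDeriv (𝕜 := ℝ)]
  simp only [Function.comp_apply, ContinuousMultilinearMap.coe_restrictScalars]
  rw [iteratedFDeriv_apply_eq_iteratedDeriv_mul_prod]
  simp

end Derivatives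

section Cluster

open Filter Topology

variable {V : Type*} [DecidableEq V] {S : Finset (Finset V)}

/-- The basis vector of `S → ℝ` at `X`. -/
noncomputable def basisVec (X : S) : S → ℝ := Pi.single X 1

lemma foldr_partialDeriv_eventuallyEq {f : (S → ℝ) → ℂ} (hf : AnalyticAt ℝ f 0) {n : ℕ}
    (r : Fin n → S) :
    (List.ofFn r).foldr partialDeriv f =ᶠ[𝓝 0]
      fun x => iteratedFDeriv ℝ n f x (fun i => basisVec (r i)) := by
  induction n with
  | zero => simp
  | succ n ih =>
    rw [List.ofFn_succ, List.foldr_cons]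
    filter_upwards [(ih fun i => r i.succ).eventuallyEq_nhds, hf.eventually_analyticAt]
      with x hx hfx
    have hd : DifferentiableAt ℝ (iteratedFDeriv ℝ n f) x := 
      (hfx.contDiffAt (n := ⊤)).differentiableAt_iteratedFDeriv (by simp)
    have hd' : DifferentiableAt ℝ
        (fun x => iteratedFDeriv ℝ n f x (fun i => basisVec (r i.succ))) x :=
      hd.continuousMultilinear_apply_const _
    rw [partialDeriv, hx.lineDeriv_eq, hd'.lineDeriv_eq_fderiv, iteratedFDeriv_succ_apply_left,
      fderiv_continuousMultilinear_apply_const_apply hd]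
    rfl

lemma exists_perm_of_ofFn_perm {α : Type*} {n : ℕ} {r r' : Fin n → α}
    (h : (List.ofFn r : Multiset α) = List.ofFn r') : ∃ σ : Equiv.Perm (Fin n), r' ∘ σ = r := by
  classical
  rw [← Fin.univ_val_map, ← Fin.univ_val_map] at h
  have hc : ∀ a, Fintype.card {i // r i = a} = Fintype.card {i // r' i = a} := fun a => by
    have := congrArg (Multiset.count a) h
    rw [Multiset.count_map, Multiset.count_map] at this
    simp only [eq_comm (a := a)] at this
    rw [Fintype.card_subtype, Fintype.card_subtype]
    exact this
  exact ⟨Equiv.ofFiberEquiv fun a => Fintype.equivOfCardEq (hc a),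
    funext fun i => Equiv.ofFiberEquiv_map _ i⟩

lemma clusterDeriv_eq_iteratedFDeriv {f : (S → ℝ) → ℂ} (hf : AnalyticAt ℝ f 0) {n : ℕ}
    (r : Fin n → S) :
    clusterDeriv (List.ofFn r : Multiset S) f =
      iteratedFDeriv ℝ n f 0 (fun i => basisVec (r i)) := by
  have hlen : (List.ofFn r : Multiset S).toList.length = n := by simp
  obtain ⟨r', hr'⟩ : ∃ r' : Fin n → S, List.ofFn r' = (List.ofFn r : Multiset S).toList := by
    refine ⟨fun i => (List.ofFn r : Multiset S).toList.get (i.cast hlen.symm), ?_⟩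
    refine List.ext_get (by simp) fun i h1 h2 => by simp
  obtain ⟨σ, hσ⟩ := exists_perm_of_ofFn_perm (r := r) (r' := r') (by
    rw [hr', Multiset.coe_toList])
  rw [clusterDeriv, ← hr', (foldr_partialDeriv_eventuallyEq hf r').eq_of_nhds, ← hσ]
  exact (hf.contDiffAt.iteratedFDeriv_comp_perm (fun i => basisVec (r' i)) σ).symm

/-- A multiset of size `m` has `m! / W!` orderings. -/
lemma card_orderings_mul_clusterFactorial {n : ℕ} (r : Fin n → S) :
    (Finset.univ.filter fun r' : Fin n → S =>
      (List.ofFn r' : Multiset S) = List.ofFn r).card *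
        clusterFactorial (List.ofFn r : Multiset S) = n.factorial := by
  -- Permutations act transitively on the orderings, and the stabilizer has order `W!`.
  have hstab : clusterFactorial (List.ofFn r : Multiset S) =
      (Finset.univ.filter fun σ : Equiv.Perm (Fin n) => r ∘ σ = r).card := by
    rw [← Fintype.card_subtype, DomMulAct.stabilizer_card, clusterFactorial]
    refine Finset.prod_congr rfl fun X _ => ?_
    rw [← Fin.univ_val_map, Multiset.count_map, Fintype.card_subtype]
    simp only [eq_comm (a := X)]
    rfl
  have hmaps : ∀ σ ∈ (Finset.univ : Finset (Equiv.Perm (Fin n))), r ∘ σ ∈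
      Finset.univ.filter fun r' : Fin n → S => (List.ofFn r' : Multiset S) = List.ofFn r :=
    fun σ _ => by simpa using σ.ofFn_comp_perm r
  have := Finset.card_eq_sum_card_fiberwise hmaps
  rw [Finset.card_univ, Fintype.card_perm, Fintype.card_fin] at this
  rw [this, ← smul_eq_mul, ← Finset.sum_const]
  refine Finset.sum_congr rfl fun r' hr' => ?_
  obtain ⟨τ, rfl⟩ := exists_perm_of_ofFn_perm (Finset.mem_filter.1 hr').2
  rw [hstab]
  refine Finset.card_bij (fun σ _ => σ * τ) (fun σ hσ => ?_) (fun σ _ σ' _ h => mul_right_cancel h)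
    fun σ hσ => ⟨σ * τ⁻¹, ?_, by simp⟩
  · simp only [Finset.mem_filter, Finset.mem_univ, true_and] at hσ ⊢
    rw [Equiv.Perm.coe_mul, ← Function.comp_assoc, hσ]
  · simp only [Finset.mem_filter, Finset.mem_univ, true_and] at hσ ⊢
    rw [Equiv.Perm.coe_mul, ← Function.comp_assoc, hσ, Function.comp_assoc]
    ext i
    simp

/-- The multivariate Taylor coefficients of order `m` assemble to the iterated derivative along the
diagonal. -/
theorem sum_clusterDeriv {f : (S → ℝ) → ℂ} (hf : AnalyticAt ℝ f 0) (l : S → ℝ) (m : ℕ) :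
    ∑ W : Sym S m, ((clusterMonomial l W : ℝ) : ℂ) / (clusterFactorial (W : Multiset S) : ℂ) *
      clusterDeriv (W : Multiset S) f =
        1 / (m.factorial : ℂ) * iteratedFDeriv ℝ m f 0 (fun _ => l) := by
  have hl : l = ∑ X : S, l X • basisVec X := by
    ext Y
    simp [basisVec, Finset.sum_apply, Pi.single_apply]
  have hexp : iteratedFDeriv ℝ m f 0 (fun _ => l) =
      ∑ r : Fin m → S, ((∏ i, l (r i) : ℝ) : ℂ) * clusterDeriv (List.ofFn r : Multiset S) f := by
    conv_lhs => rw [hl]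
    rw [ContinuousMultilinearMap.map_sum]
    refine Finset.sum_congr rfl fun r _ => ?_
    rw [ContinuousMultilinearMap.map_smul_univ, clusterDeriv_eq_iteratedFDeriv hf,
      Complex.real_smul]
  let q : (Fin m → S) → Sym S m := fun r => ⟨List.ofFn r, by simp⟩
  rw [hexp, ← Finset.sum_fiberwise Finset.univ q, Finset.mul_sum]
  refine Finset.sum_congr rfl fun W _ => ?_
  obtain ⟨r, rfl⟩ : ∃ r, q r = W := by
    refine ⟨fun i => (W : Multiset S).toList.get (i.cast (by simp)), Sym.ext ?_⟩
    have : List.ofFn (fun i : Fin m => (W : Multiset S).toList.get (i.cast (by simp))) =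
        (W : Multiset S).toList := List.ext_get (by simp) fun i h1 h2 => by simp
    change ((List.ofFn _ : List S) : Multiset S) = _
    rw [this, Multiset.coe_toList]
  have hmon : ∀ r' : Fin m → S, clusterMonomial l (List.ofFn r' : Multiset S) = ∏ i, l (r' i) := by
    intro r'
    rw [clusterMonomial, ← Finset.prod_fiberwise Finset.univ r']
    refine Finset.prod_congr rfl fun X _ => ?_
    rw [Finset.prod_congr rfl fun i hi => congrArg l (Finset.mem_filter.1 hi).2, Finset.prod_const,
      ← Fin.univ_val_map, Multiset.count_map]
    simp only [eq_comm (a := X)]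
    rfl
  have hcoe : ∀ r' : Fin m → S, ((q r' : Sym S m) : Multiset S) = List.ofFn r' := fun _ => rfl
  have hcongr : ∀ r' ∈ Finset.univ.filter (fun r' => q r' = q r),
      ((∏ i, l (r' i) : ℝ) : ℂ) * clusterDeriv (List.ofFn r' : Multiset S) f =
        ((∏ i, l (r i) : ℝ) : ℂ) * clusterDeriv (List.ofFn r : Multiset S) f := by
    intro r' hr'
    have : (List.ofFn r' : Multiset S) = List.ofFn r :=
      congrArg Sym.toMultiset (Finset.mem_filter.1 hr').2
    rw [← hmon, ← hmon, this]
  have hfil : (Finset.univ.filter fun r' => q r' = q r) = Finset.univ.filter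
      fun r' : Fin m → S => (List.ofFn r' : Multiset S) = List.ofFn r :=
    Finset.filter_congr fun r' _ => Sym.coe_inj.symm
  rw [Finset.sum_congr rfl hcongr, Finset.sum_const, hcoe, hmon, hfil, nsmul_eq_mul,
    ← card_orderings_mul_clusterFactorial r]
  have h0 : (clusterFactorial (List.ofFn r : Multiset S) : ℂ) ≠ 0 := by
    exact_mod_cast Finset.prod_ne_zero_iff.2 fun X _ => Nat.factorial_ne_zero _
  have h1 : ((Finset.univ.filter fun r' : Fin m → S =>
      (List.ofFn r' : Multiset S) = List.ofFn r).card : ℂ) ≠ 0 := by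
    exact_mod_cast Finset.card_ne_zero_of_mem (a := r) (by simp)
  push_cast
  field_simp

end Cluster

/-! ### The cluster expansion -/

section Expansion

open Filter Topology

variable {V : Type*} [Fintype V] [DecidableEq V] {d : ℕ} {S : Finset (Finset V)}
  {h : S → Op V d} {ρ : Op V d}

lemma loschmidt_zero (hρ : IsProductState ρ) (t : ℂ) : loschmidt h ρ 0 t = 1 := by
  simp [loschmidt, hamiltonian, NormedSpace.exp_zero, hρ.trace_eq_one]

lemma analyticAt_loschmidt (l : S → ℝ) (t : ℂ) : AnalyticAt ℝ (fun l => loschmidt h ρ l t) l := by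
  simp_rw [loschmidt_eq_partialPartition]
  refine (analyticAt_partialPartition Finset.univ _).restrictScalars.comp
    (f := fun (l : S → ℝ) X => t * (-Complex.I * (l X : ℂ))) ?_
  refine analyticAt_pi_iff.2 fun X => analyticAt_const.mul (analyticAt_const.mul ?_)
  exact (Complex.ofRealCLM.comp
    (ContinuousLinearMap.proj (R := ℝ) (φ := fun _ : S => ℝ) X)).analyticAt l

lemma analyticAt_log_loschmidt (hρ : IsProductState ρ) (t : ℂ) :
    AnalyticAt ℝ (fun l => Complex.log (loschmidt h ρ l t)) 0 := by
  have h1 : loschmidt h ρ 0 t ∈ Complex.slitPlane := by simp [loschmidt_zero hρ]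
  exact ((analyticAt_clog h1).restrictScalars (𝕜 := ℝ)).comp
    (f := fun l => loschmidt h ρ l t) (analyticAt_loschmidt 0 t)

/-- Near a point where both factors equal `1`, no branch cut is crossed. -/
lemma log_mul_eventually {α : Type*} [TopologicalSpace α] {a b : α → ℂ} {x : α}
    (ha : ContinuousAt a x) (hb : ContinuousAt b x) (ha1 : a x = 1) (hb1 : b x = 1) :
    ∀ᶠ y in 𝓝 x, Complex.log (a y * b y) = Complex.log (a y) + Complex.log (b y) := by
  have harg : ∀ c : α → ℂ, ContinuousAt c x → c x = 1 →
      ∀ᶠ y in 𝓝 x, c y ≠ 0 ∧ |(c y).arg| < Real.pi / 2 := by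
    intro c hc hc1
    refine (hc.eventually_ne (by simp [hc1])).and ?_
    have : ContinuousAt (fun y => |(c y).arg|) x :=
      ((Complex.continuousAt_arg (by simp [hc1])).comp hc).abs
    exact this.eventually_lt_const (by simp [hc1, Real.pi_pos])
  filter_upwards [harg a ha ha1, harg b hb hb1] with y ⟨ha0, ha⟩ ⟨hb0, hb⟩
  rw [abs_lt] at ha hb
  exact Complex.log_mul ha0 hb0 ⟨by linarith, by linarith⟩

/-- A disconnected cluster splits into two families of subsystems that do not overlap. These
families may share an empty subsystem, so the two kinds of directions are kept apart in a product
space rather than in complementary coordinates. -/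
theorem clusterDeriv_eq_zero_of_not_connected (hρ : IsProductState ρ)
    (hh : ∀ X, ActsOn (h X) X.1) (t : ℂ) {W : Multiset S} (hW : W ≠ 0)
    (hconn : ¬ (clusterGraph W).Connected) :
    clusterDeriv W (fun l => Complex.log (loschmidt h ρ l t)) = 0 := by
  classical
  have hne : Nonempty W.ToType := by
    rw [← Fintype.card_pos_iff, Multiset.card_coe]
    exact Multiset.card_pos.2 hW
  obtain ⟨p, q, hpq⟩ : ∃ p q, ¬ (clusterGraph W).Reachable p q := by
    by_contra! hall
    exact hconn ⟨hall⟩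
  set P : W.ToType → Prop := fun x => (clusterGraph W).Reachable p x with hP
  have hPP : ∀ a b, P a → ¬ P b → Disjoint a.1.1 b.1.1 := by
    intro a b ha hb
    by_contra hdis
    refine hb (ha.trans (SimpleGraph.Adj.reachable ⟨fun e => hb (e ▸ ha), ?_⟩))
    rwa [← Finset.not_disjoint_iff_nonempty_inter]
  let A : Finset S := (Finset.univ.filter P).image fun x => x.1
  let B : Finset S := (Finset.univ.filter fun x => ¬ P x).image fun x => x.1
  have hAB : ∀ X ∈ A, ∀ Y ∈ B, Disjoint X.1 Y.1 := by
    intro X hX Y hY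
    obtain ⟨a, ha, rfl⟩ := Finset.mem_image.1 hX
    obtain ⟨b, hb, rfl⟩ := Finset.mem_image.1 hY
    exact hPP a b (Finset.mem_filter.1 ha).2 (Finset.mem_filter.1 hb).2
  let e := (Fintype.equivFin W.ToType).symm
  let r : Fin (Fintype.card W.ToType) → S := fun i => (e i).1
  have hr : (List.ofFn r : Multiset S) = W := by
    rw [← Fin.univ_val_map]
    conv_rhs => rw [← Multiset.map_univ_coe W, ← Multiset.map_univ_val_equiv e, Multiset.map_map]
    rfl
  rw [← hr, clusterDeriv_eq_iteratedFDeriv (analyticAt_log_loschmidt hρ t)]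
  let π : Finset S → (S → ℝ) →L[ℝ] (S → ℝ) := fun C => ContinuousLinearMap.pi fun X =>
    if X ∈ C then ContinuousLinearMap.proj X else 0
  have hπ : ∀ (C : Finset S) (u : S → ℝ) (X : S), π C u X = if X ∈ C then u X else 0 := by
    intro C u X
    simp only [π, ContinuousLinearMap.pi_apply]
    split_ifs <;> rfl
  have hπe : ∀ (C : Finset S) (X : S), X ∈ C → π C (basisVec X) = basisVec X := by
    intro C X hX
    ext Y
    rw [hπ, basisVec, Pi.single_apply]
    by_cases hY : Y = X
    · simp [hY, hX]
    · simp [hY]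
  let T : (S → ℝ) × (S → ℝ) →L[ℝ] (S → ℝ) :=
    (π A).comp (ContinuousLinearMap.fst ℝ _ _) + (π B).comp (ContinuousLinearMap.snd ℝ _ _)
  have hT : ∀ x, T x = π A x.1 + π B x.2 := fun _ => rfl
  let w : Fin (Fintype.card W.ToType) → (S → ℝ) × (S → ℝ) := fun i =>
    if P (e i) then (basisVec (r i), 0) else (0, basisVec (r i))
  have hTw : ∀ i, T (w i) = basisVec (r i) := by
    intro i
    by_cases hi : P (e i)
    · have : r i ∈ A := Finset.mem_image.2 ⟨e i, by simpa using hi, rfl⟩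
      rw [hT]
      simp only [w, if_pos hi, map_zero, add_zero]
      exact hπe A _ this
    · have : r i ∈ B := Finset.mem_image.2 ⟨e i, by simpa using hi, rfl⟩
      rw [hT]
      simp only [w, if_neg hi, map_zero, zero_add]
      exact hπe B _ this
  have hmul : ∀ x, loschmidt h ρ (T x) t =
      loschmidt h ρ (T (x.1, 0)) t * loschmidt h ρ (T (0, x.2)) t := by
    have hsum : ∀ (C : Finset S) (u : S → ℝ),
        ((-Complex.I * t) • hamiltonian h (π C u)) =
          ∑ X ∈ C, (-Complex.I * t * (u X : ℂ)) • h X := by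
      intro C u
      simp only [hamiltonian, hπ, Finset.smul_sum, smul_smul]
      rw [← Finset.sum_subset (Finset.subset_univ C)]
      · exact Finset.sum_congr rfl fun X hX => by rw [if_pos hX]
      · intro X _ hX
        simp [hX]
    have hadd : ∀ u v : S → ℝ, hamiltonian h (u + v) = hamiltonian h u + hamiltonian h v := by
      intro u v
      simp [hamiltonian, add_smul, Finset.sum_add_distrib]
    intro x
    simp only [hT, map_zero, add_zero, zero_add]
    rw [loschmidt, loschmidt, loschmidt, hadd, smul_add, hsum, hsum]
    exact partialPartition_eq_mul hρ hh _ _ hAB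
  have hcont : ∀ Q : (S → ℝ) × (S → ℝ) →L[ℝ] (S → ℝ),
      ContinuousAt (fun x => loschmidt h ρ (Q x) t) 0 := fun Q =>
    ContinuousAt.comp (g := fun l => loschmidt h ρ l t)
      (analyticAt_loschmidt _ t).continuousAt Q.continuous.continuousAt
  have hsep : ∀ᶠ x in 𝓝 (0 : (S → ℝ) × (S → ℝ)), Complex.log (loschmidt h ρ (T x) t) =
      Complex.log (loschmidt h ρ (T (x.1, 0)) t) + Complex.log (loschmidt h ρ (T (0, x.2)) t) := by
    have h1 : ∀ Q : (S → ℝ) × (S → ℝ) →L[ℝ] (S → ℝ), loschmidt h ρ (Q 0) t = 1 := fun Q => by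
      rw [map_zero, loschmidt_zero hρ]
    refine (log_mul_eventually
      (hcont (T.comp ((ContinuousLinearMap.inl ℝ _ _).comp (ContinuousLinearMap.fst ℝ _ _))))
      (hcont (T.comp ((ContinuousLinearMap.inr ℝ _ _).comp (ContinuousLinearMap.snd ℝ _ _))))
      (h1 _) (h1 _)).mono fun x hx => ?_
    rw [hmul]
    exact hx
  have := iteratedFDeriv_eq_zero_of_separate (f := fun l => Complex.log (loschmidt h ρ l t)) T
    (analyticAt_log_loschmidt hρ t) hsep w (i := e.symm p) (j := e.symm q)
    (by simp [w, hP]) (by simp [w, hP, hpq])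
  simpa only [hTw] using this

/-- The truncated cluster expansion is the Taylor polynomial in time of the logarithm. -/
theorem truncatedExpansion_eq_taylor (hρ : IsProductState ρ) (hh : ∀ X, ActsOn (h X) X.1)
    {l : S → ℝ} {g : ℂ → ℂ} (hg0 : g 0 = 0) (hg : AnalyticAt ℂ g 0)
    (hexp : ∀ᶠ s in 𝓝 0, Complex.exp (g s) = loschmidt h ρ l s) (M : ℕ) (t : ℂ) :
    truncatedExpansion h ρ l M t =
      ∑ m ∈ Finset.range (M + 1), t ^ m / m.factorial * iteratedDeriv m g 0 := by
  have hf := analyticAt_log_loschmidt (h := h) hρ t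
  have hlim : Tendsto (fun s : ℝ => (s : ℂ) * t) (𝓝 0) (𝓝 0) := by
    have : Continuous fun s : ℝ => (s : ℂ) * t := by fun_prop
    simpa using this.tendsto 0
  have him : ∀ᶠ z in 𝓝 (0 : ℂ), |(g z).im| < Real.pi := by
    have : ContinuousAt (fun z => |(g z).im|) 0 :=
      (Complex.continuous_im.continuousAt.comp hg.continuousAt).abs
    exact this.eventually_lt_const (by simp [hg0, Real.pi_pos])
  have hfg : ∀ᶠ s : ℝ in 𝓝 0, Complex.log (loschmidt h ρ (s • l) t) = g (s * t) := by
    filter_upwards [hlim.eventually hexp, hlim.eventually him] with s hs hs'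
    rw [abs_lt] at hs'
    have hscale : loschmidt h ρ (s • l) t = loschmidt h ρ l (s * t) := by
      simp only [loschmidt_eq_partialPartition, Pi.smul_apply, smul_eq_mul, Complex.ofReal_mul]
      congr 1
      ext X
      ring
    rw [hscale, ← hs, Complex.log_exp hs'.1 hs'.2.le]
  have horder : ∀ m ∈ Finset.Icc 1 M, ∑ W ∈ connectedClusters S m,
      ((clusterMonomial l W : ℝ) : ℂ) / (clusterFactorial (W : Multiset S) : ℂ) *
        clusterDeriv (W : Multiset S) (fun l' => Complex.log (loschmidt h ρ l' t)) =
      t ^ m / m.factorial * iteratedDeriv m g 0 := by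
    intro m hm
    have h1 := sum_clusterDeriv hf l m
    rw [iteratedFDeriv_diagonal_eq hf hg l t hfg m] at h1
    rw [Finset.sum_subset (Finset.subset_univ _), h1]
    · ring
    · intro W _ hW
      rw [clusterDeriv_eq_zero_of_not_connected hρ hh t, mul_zero]
      · rw [← Multiset.card_pos, Sym.card_coe]
        exact (Finset.mem_Icc.1 hm).1
      · simpa [connectedClusters] using hW
  rw [truncatedExpansion, Finset.sum_congr rfl horder, Finset.range_eq_Ico,
    Finset.sum_eq_sum_Ico_succ_bot (Nat.succ_pos M)]
  simp only [iteratedDeriv_zero, hg0, mul_zero, zero_add]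
  rfl

end Expansion

end QSpin

/-- The function `logL` is the branch of `log L` on the disc `|t| < t_L^*` with `logL 0 = 0`; the
disc being connected, continuity and the two equations determine it there. -/
theorem mainTheorem3 {V : Type*} [Fintype V] [DecidableEq V] (d : ℕ)
    (S : Finset (Finset V)) (hS : 1 ≤ QSpin.maxDeg S)
    (h : S → QSpin.Op V d)
    (h_herm : ∀ X, (h X).IsHermitian)
    (h_supp : ∀ X : S, QSpin.HasSupport (h X) X)
    (h_norm : ∀ X, QSpin.opNorm (h X) = 1)
    (l : S → ℝ) (hl : ∀ X, |l X| ≤ 1)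
    (ρ : QSpin.Op V d) (hρ : QSpin.IsProductState ρ) :
    ∃ logL : ℂ → ℂ,
      logL 0 = 0 ∧
      (∀ t : ℂ, ‖t‖ < QSpin.loschmidtTime (QSpin.maxDeg S) →
        Complex.exp (logL t) = QSpin.loschmidt h ρ l t) ∧
      AnalyticOnNhd ℂ logL (Metric.ball 0 (QSpin.loschmidtTime (QSpin.maxDeg S))) ∧
      ∀ (M : ℕ) (t : ℂ), ‖t‖ < QSpin.loschmidtTime (QSpin.maxDeg S) →
        ‖logL t - QSpin.truncatedExpansion h ρ l M t‖ ≤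
          (S.card : ℝ) * ((‖t‖ / QSpin.loschmidtTime (QSpin.maxDeg S)) ^ (M + 1) /
            (1 - ‖t‖ / QSpin.loschmidtTime (QSpin.maxDeg S))) := by
  have hh : ∀ X : S, QSpin.ActsOn (h X) X.1 := fun X => (h_supp X).1
  have hpos : 0 < QSpin.loschmidtTime (QSpin.maxDeg S) := by
    have : (1 : ℝ) ≤ QSpin.maxDeg S := by exact_mod_cast hS
    unfold QSpin.loschmidtTime
    positivity
  obtain ⟨g, hg0, hga, hg⟩ := QSpin.exists_log_partialPartition hS hρ hh h_norm
    (c := fun X => -Complex.I * (l X : ℂ)) (fun X => by simpa using hl X) Finset.univ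
  simp only [← QSpin.loschmidt_eq_partialPartition, Finset.card_univ, Fintype.card_coe] at hg
  refine ⟨g, hg0, fun t ht => (hg t (mem_ball_zero_iff.2 ht)).1, hga, fun M t ht => ?_⟩
  rw [QSpin.truncatedExpansion_eq_taylor hρ hh hg0 (hga 0 (Metric.mem_ball_self hpos))
    (Filter.eventually_of_mem (Metric.ball_mem_nhds 0 hpos) fun s hs => (hg s hs).1)]
  exact QSpin.norm_sub_taylor_le hpos hga.differentiableOn (fun s hs => (hg s hs).2) ht M
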